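/- Let $X$ be a finite non-empty set, let $\mathcal K$ be a finite-dimensional complex Hilbert space, let $\mathcal S(\mathcal K)$ be the set of quantum states (density operators) on $\mathcal K$, and let $E : X \to \mathcal S(\mathcal K)$, $x \mapsto \rho_x$, be an encoding. For a probability distribution $\mu = (p_x)_{x\in X}$ on $X$ let $I_\mu(E) = S(A)+S(B)-S(AB)$ be the quantum mutual information (with the von Neumann entropy $S(\rho) = -\operatorname{Tr}\rho\log_2\rho$) between the two systems $A$, $B$ of the bipartite state $\sum_{x\in X} p_x\,|x\rangle\langle x|\otimes\rho_x$, and let the maximum possible information in $E$ be $T(E) = \max_\mu I_\mu(E)$. In the remote state preparation problem $\mathrm{RSP}(X,E,\epsilon)$ Alice gets an input $x\in X$. Alice and Bob share an arbitrary finite-dimensional bipartite state that does not depend on $x$ (prior entanglement), and run a two-way quantum communication protocol of finitely many rounds: in each round one of them applies a quantum operation (which may depend on $x$ if it is Alice's) to the register that he or she holds, and sends some number of qubits, fixed by the protocol, to the other. At the end Bob applies a quantum operation to his register and must hold a state $\sigma_x\in\mathcal S(\mathcal K)$ with fidelity $F(\sigma_x,\rho_x) = \operatorname{Tr}\sqrt{\sqrt{\sigma_x}\,\rho_x\sqrt{\sigma_x}}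 \ge 1-\epsilon$, for every $x \in X$. Let $Q^{pub}(\mathrm{RSP}(X,E,\epsilon))$ be the least total number of qubits, counted in both directions, exchanged by a protocol that solves $\mathrm{RSP}(X,E,\epsilon)$. Then $$Q^{pub}(\mathrm{RSP}(X,E,0)) \;\ge\; \frac{T(E)}{2}.$$ -/

import Mathlib

open scoped Kronecker Matrix ENNReal ComplexOrder

namespace RSP

universe u v

/-- A quantum state of the finite-dimensional Hilbert space `ℂ^n`: a positive semidefinite matrix
of trace one. -/
structure State (n : Type*) [Fintype n] where
  mat : Matrix n n ℂ
  posSemidef : mat.PosSemidef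
  trace_eq_one : mat.trace = 1

/-- The reduced matrix on the second factor (trace out the first factor). -/
def traceFst {A B : Type*} [Fintype A] (M : Matrix (A × B) (A × B) ℂ) : Matrix B B ℂ :=
  Matrix.of fun b b' => ∑ a, M (a, b) (a, b')

/-- The reduced matrix on the first factor (trace out the second factor). -/
def traceSnd {A B : Type*} [Fintype B] (M : Matrix (A × B) (A × B) ℂ) : Matrix A A ℂ :=
  Matrix.of fun a a' => ∑ b, M (a, b) (a', b)

/-- The von Neumann entropy `- Tr ρ log₂ ρ`, in bits. -/
noncomputable def entropy {n : Type*} [Fintype n] [DecidableEq n] (ρ : Matrix n n ℂ) : ℝ :=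
  (cfc Real.negMulLog ρ).trace.re / Real.log 2

/-- The quantum mutual information `I(A : B) = S(A) + S(B) - S(AB)` of a bipartite state. -/
noncomputable def mutualInfo {A B : Type*} [Fintype A] [DecidableEq A] [Fintype B] [DecidableEq B]
    (ρ : Matrix (A × B) (A × B) ℂ) : ℝ :=
  entropy (traceSnd ρ) + entropy (traceFst ρ) - entropy ρ

/-- The fidelity `F(ρ, σ) = Tr √(√ρ σ √ρ)`. -/
noncomputable def fidelity {n : Type*} [Fintype n] [DecidableEq n] (ρ σ : Matrix n n ℂ) : ℝ :=
  (cfc Real.sqrt (cfc Real.sqrt ρ * σ * cfc Real.sqrt ρ)).trace.re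

open scoped Matrix.Norms.L2Operator in
theorem continuous_entropy {n Y : Type*} [Fintype n] [DecidableEq n] [TopologicalSpace Y]
    {M : Y → Matrix n n ℂ} (hM : Continuous M) (h : ∀ y, (M y).IsHermitian) :
    Continuous fun y => entropy (M y) := by
  have hc : Continuous fun y => cfc Real.negMulLog (M y) :=
    Continuous.cfc_of_mem_nhdsSet (s := Set.univ) Real.negMulLog Filter.univ_mem hM
      (fun y => h y) Real.continuous_negMulLog.continuousOn
  unfold entropy
  exact (Complex.continuous_re.comp hc.matrix_trace).div_const _

section Encoding

variable {X : Type u} {K : Type v} [Fintype X] [DecidableEq X] [Fintype K] [DecidableEq K]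

/-- The classical-quantum state `∑ x, μ(x) |x⟩⟨x| ⊗ E(x)`. -/
noncomputable def cqState (E : X → State K) (μ : X → ℝ) : Matrix (X × K) (X × K) ℂ :=
  ∑ x, (μ x : ℂ) • (Matrix.single x x (1 : ℂ) ⊗ₖ (E x).mat)

/-- The mutual information between the two systems of `cqState E μ`. -/
noncomputable def info (E : X → State K) (μ : X → ℝ) : ℝ :=
  mutualInfo (cqState E μ)

/-- The maximum possible information in the encoding `E`: the maximum of `info E μ` over all
probability distributions `μ` on `X` (attained, see `isGreatest_maxInfo`). -/
noncomputable def maxInfo (E : X → State K) : ℝ :=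
  sSup (info E '' stdSimplex ℝ X)

/-- The maximum in the definition of `maxInfo` exists. -/
theorem isGreatest_maxInfo [Nonempty X] (E : X → State K) :
    IsGreatest (info E '' stdSimplex ℝ X) (maxInfo E) := by
  have hH : ∀ μ : X → ℝ, (cqState E μ).IsHermitian := by
    intro μ
    unfold cqState Matrix.IsHermitian
    simp [Matrix.conjTranspose_sum, Matrix.conjTranspose_smul, Matrix.conjTranspose_kronecker,
      fun x => (E x).posSemidef.1.eq]
  have hc : Continuous (cqState E) := by
    unfold cqState
    fun_prop
  have h1 : Continuous (info E) := by
    unfold info mutualInfo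
    refine ((continuous_entropy ?_ ?_).add (continuous_entropy ?_ ?_)).sub
      (continuous_entropy hc hH)
    · refine continuous_matrix fun a a' => continuous_finsetSum _ fun b _ => ?_
      exact hc.matrix_elem _ _
    · intro μ
      ext a a'
      simp only [traceSnd, Matrix.conjTranspose_apply, Matrix.of_apply, star_sum, (hH μ).apply]
    · refine continuous_matrix fun a a' => continuous_finsetSum _ fun b _ => ?_
      exact hc.matrix_elem _ _
    · intro μ
      ext a a'
      simp only [traceFst, Matrix.conjTranspose_apply, Matrix.of_apply, star_sum, (hH μ).apply]
  have hne : (stdSimplex ℝ X).Nonempty := Set.nonempty_coe_sort.mp inferInstance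
  exact ((isCompact_stdSimplex ℝ X).image h1).isGreatest_sSup (hne.image _)

end Encoding

/-- A quantum channel from `ℂ^m` to `ℂ^n` (a completely positive trace-preserving map), given by
Kraus operators. -/
structure Channel (m n : Type*) [Fintype m] [DecidableEq m] [Fintype n] where
  rank : ℕ
  kraus : Fin rank → Matrix n m ℂ
  sum_eq_one : ∑ i, (kraus i)ᴴ * kraus i = 1

namespace Channel

variable {m n A B : Type*} [Fintype m] [DecidableEq m] [Fintype n]

/-- The action of a channel. -/
def apply (Φ : Channel m n) (ρ : Matrix m m ℂ) : Matrix n n ℂ :=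
  ∑ i, Φ.kraus i * ρ * (Φ.kraus i)ᴴ

/-- The action `Φ ⊗ id` of a channel on the first factor of a bipartite system. -/
def applyFst [Fintype B] [DecidableEq B] (Φ : Channel m n) (ρ : Matrix (m × B) (m × B) ℂ) :
    Matrix (n × B) (n × B) ℂ :=
  ∑ i, (Φ.kraus i ⊗ₖ (1 : Matrix B B ℂ)) * ρ * (Φ.kraus i ⊗ₖ (1 : Matrix B B ℂ))ᴴ

/-- The action `id ⊗ Φ` of a channel on the second factor of a bipartite system. -/
def applySnd [Fintype A] [DecidableEq A] (Φ : Channel m n) (ρ : Matrix (A × m) (A × m) ℂ) :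
    Matrix (A × n) (A × n) ℂ :=
  ∑ i, ((1 : Matrix A A ℂ) ⊗ₖ Φ.kraus i) * ρ * ((1 : Matrix A A ℂ) ⊗ₖ Φ.kraus i)ᴴ

end Channel

/-- The basis labels of a register of `q` qubits, whose Hilbert space is `(ℂ²)^{⊗ q}`. -/
abbrev Qubits (q : ℕ) : Type := Fin q → Fin 2

/-- The remaining part of a two-way quantum communication protocol in which Alice has a classical
input in `X`, she currently holds a register `A`, Bob holds a register `B`, and Bob has to output a
state of `ℂ^K`.

* `output Φ`: the communication is over; Bob applies `Φ` to his register and outputs the result.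
* `aliceSends q Φ P`: on input `x` Alice applies `Φ x` to her register, which produces a new
  register `A'` that she keeps and `q` qubits that she sends to Bob; then they go on with `P`.
* `bobSends q Φ P`: Bob applies `Φ` to his register, which produces a new register `B'` that he
  keeps and `q` qubits that he sends to Alice; then they go on with `P`. -/
inductive Rounds (X : Type u) (K : Type v) [Fintype K] :
    (A B : Type) → [Fintype A] → [DecidableEq A] → [Fintype B] → [DecidableEq B] →
      Type (max u v 1)
  | output {A B : Type} [Fintype A] [DecidableEq A] [Fintype B] [DecidableEq B]
      (Φ : Channel B K) : Rounds X K A B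
  | aliceSends {A B A' : Type} [Fintype A] [DecidableEq A] [Fintype B] [DecidableEq B]
      [Fintype A'] [DecidableEq A'] (q : ℕ) (Φ : X → Channel A (A' × Qubits q))
      (P : Rounds X K A' (Qubits q × B)) : Rounds X K A B
  | bobSends {A B B' : Type} [Fintype A] [DecidableEq A] [Fintype B] [DecidableEq B]
      [Fintype B'] [DecidableEq B'] (q : ℕ) (Φ : Channel B (Qubits q × B'))
      (P : Rounds X K (A × Qubits q) B') : Rounds X K A B

namespace Rounds

variable {X : Type u} {K : Type v} [Fintype K]

/-- The total number of qubits that are exchanged, in both directions. -/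
def cost : {A B : Type} → [Fintype A] → [DecidableEq A] → [Fintype B] → [DecidableEq B] →
    Rounds X K A B → ℕ
  | _, _, _, _, _, _, @output _ _ _ _ _ _ _ _ _ _ => 0
  | _, _, _, _, _, _, @aliceSends _ _ _ _ _ _ _ _ _ _ _ _ q _ P => q + P.cost
  | _, _, _, _, _, _, @bobSends _ _ _ _ _ _ _ _ _ _ _ _ q _ P => q + P.cost

/-- Bob's output on Alice's input `x`, when the joint state of both registers is `ρ`. -/
noncomputable def run (x : X) : {A B : Type} → [Fintype A] → [DecidableEq A] → [Fintype B] →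
    [DecidableEq B] → Rounds X K A B → Matrix (A × B) (A × B) ℂ → Matrix K K ℂ
  | _, _, _, _, _, _, @output _ _ _ _ _ _ _ _ _ Φ, ρ => Φ.apply (traceFst ρ)
  | _, _, _, _, _, _, @aliceSends _ _ _ _ _ _ _ _ _ _ _ _ _ Φ P, ρ =>
      P.run x (Matrix.reindex (Equiv.prodAssoc _ _ _) (Equiv.prodAssoc _ _ _) ((Φ x).applyFst ρ))
  | _, _, _, _, _, _, @bobSends _ _ _ _ _ _ _ _ _ _ _ _ _ Φ P, ρ =>
      P.run x (Matrix.reindex (Equiv.prodAssoc _ _ _).symm (Equiv.prodAssoc _ _ _).symm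
        (Φ.applySnd ρ))

end Rounds

/-- A protocol with prior entanglement: an arbitrary bipartite state shared by Alice and Bob, which
does not depend on Alice's input, followed by finitely many rounds of communication. -/
structure Protocol (X : Type u) (K : Type v) [Fintype K] where
  A : Type
  B : Type
  [fintypeA : Fintype A]
  [decEqA : DecidableEq A]
  [fintypeB : Fintype B]
  [decEqB : DecidableEq B]
  shared : State (A × B)
  rounds : Rounds X K A B

section Complexity

variable {X : Type u} {K : Type v} [Fintype K] [DecidableEq K]

/-- The number of qubits exchanged by the protocol. -/
def Protocol.cost (P : Protocol X K) : ℕ :=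
  letI := P.fintypeA
  letI := P.decEqA
  letI := P.fintypeB
  letI := P.decEqB
  P.rounds.cost

/-- Bob's final state on Alice's input `x`. -/
noncomputable def Protocol.result (P : Protocol X K) (x : X) : Matrix K K ℂ :=
  letI := P.fintypeA
  letI := P.decEqA
  letI := P.fintypeB
  letI := P.decEqB
  P.rounds.run x P.shared.mat

/-- The protocol solves the remote state preparation problem for the encoding `E` with error `ε`:
on every input `x` the fidelity of Bob's final state with `E x` is at least `1 - ε`. -/
def Protocol.Solves (P : Protocol X K) (E : X → State K) (ε : ℝ) : Prop :=
  ∀ x, 1 - ε ≤ fidelity (P.result x) (E x).mat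

/-- The communication complexity, with prior entanglement, of remote state preparation for the
encoding `E` with error `ε`: the least number of qubits exchanged by a protocol that solves the
problem (`⊤` if there were none). -/
noncomputable def Qpub (E : X → State K) (ε : ℝ) : ℕ∞ :=
  ⨅ (P : Protocol X K) (_ : P.Solves E ε), (P.cost : ℕ∞)

end Complexity

end RSP

/-! Bob's initial reduced state does not depend on Alice's input, and communication can change this
only slowly in the positive semidefinite order. The invariant is one matrix `τ`, independent of `x`,
that dominates Bob's reduced state on every input. Bob's channels preserve the order and the trace,
and discarding qubits does not enlarge the trace. Alice's local operations do not affect Bob's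
reduced state. If she sends him `q` qubits, then `ρ_QB ≤ 2^q • (1 ⊗ ρ_B)`, and the new bound has
trace `4^q` times the old one (`Rounds.exists_uniform_bound`). So a protocol of cost `q` yields
outputs dominated by a common `τ` with `Tr τ ≤ 4^q`; at error zero these outputs are the states
`ρ_x` themselves (`eq_of_one_le_fidelity`).

The mutual information of the classical-quantum state is the Holevo quantity `S(σ) - ∑ p_x S(ρ_x)`
with `σ = ∑ p_x ρ_x`. Gibbs' inequality bounds `S(σ)` by `-Tr σ log τ + log Tr τ`, and operator
monotonicity of the logarithm gives `-S(ρ_x) ≤ Tr ρ_x log τ`. On averaging, the terms in `log τ`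
cancel and `log Tr τ ≤ 2q log 2` remains (`log_two_mul_info_le`). -/

namespace RSP

open Matrix Polynomial

/-! ### Traces of functions of Hermitian matrices -/

section FunctionalCalculus

variable {n : Type*} [Fintype n] [DecidableEq n]

/-- The spectrum is finite, so continuity is automatic, even for functions singular at `0` such as
the logarithm or `(√x)⁻¹`. -/
theorem continuousOn_spectrum (f : ℝ → ℝ) (A : Matrix n n ℂ) : ContinuousOn f (spectrum ℝ A) :=
  finite_real_spectrum.continuousOn f

theorem continuousOn_image_spectrum (f g : ℝ → ℝ) (A : Matrix n n ℂ) :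
    ContinuousOn f (g '' spectrum ℝ A) :=
  (finite_real_spectrum.image g).continuousOn f

theorem cfc_eq_unitary_mul_diagonal_mul {A : Matrix n n ℂ} (hA : A.IsHermitian) (f : ℝ → ℝ) :
    cfc f A = (hA.eigenvectorUnitary : Matrix n n ℂ) *
      diagonal (fun i => (f (hA.eigenvalues i) : ℂ)) *
        (hA.eigenvectorUnitary : Matrix n n ℂ)ᴴ := by
  rw [hA.cfc_eq, IsHermitian.cfc, Unitary.conjStarAlgAut_apply]
  rfl

theorem trace_cfc {A : Matrix n n ℂ} (hA : A.IsHermitian) (f : ℝ → ℝ) :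
    (cfc f A).trace = ∑ i, (f (hA.eigenvalues i) : ℂ) := by
  have hU : (hA.eigenvectorUnitary : Matrix n n ℂ)ᴴ * hA.eigenvectorUnitary = 1 :=
    Unitary.coe_star_mul_self _
  rw [cfc_eq_unitary_mul_diagonal_mul hA, trace_mul_cycle, hU, one_mul, trace_diagonal]

/-- The trace of `f(A)` is the sum of the values of `f` at the roots of the characteristic
polynomial. -/
theorem trace_cfc_of_charpoly_eq {ι : Type*} [Fintype ι] {A : Matrix n n ℂ} (hA : A.IsHermitian)
    (f : ℝ → ℝ) {d : ι → ℝ} (h : A.charpoly = ∏ i, (X - C (d i : ℂ))) :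
    (cfc f A).trace = ∑ i, (f (d i) : ℂ) := by
  have h1 : (Finset.univ.val.map fun i => (hA.eigenvalues i : ℂ)) =
      Finset.univ.val.map fun i => (d i : ℂ) := by
    have h2 : A.charpoly.roots = Finset.univ.val.map fun i => (d i : ℂ) := by
      have := roots_multiset_prod_X_sub_C (Finset.univ.val.map fun i => (d i : ℂ))
      rw [Multiset.map_map] at this
      rw [h, ← this]
      rfl
    rw [← h2, hA.roots_charpoly_eq_eigenvalues]
    rfl
  have h3 := congrArg (fun s => (s.map fun z : ℂ => (f z.re : ℂ)).sum) h1
  simp only [Multiset.map_map, Function.comp_def, Complex.ofReal_re] at h3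
  rw [trace_cfc hA]
  exact h3

/-- The overlaps of the eigenvectors of two Hermitian matrices. -/
noncomputable def overlap {A B : Matrix n n ℂ} (hA : A.IsHermitian) (hB : B.IsHermitian)
    (i j : n) : ℝ :=
  ‖((hA.eigenvectorUnitary : Matrix n n ℂ)ᴴ * hB.eigenvectorUnitary) i j‖ ^ 2

theorem overlap_nonneg {A B : Matrix n n ℂ} (hA : A.IsHermitian) (hB : B.IsHermitian) (i j : n) :
    0 ≤ overlap hA hB i j := sq_nonneg _

/-- Turns trace inequalities for non-commuting matrices into scalar ones, summed against nonnegative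
weights; taking `f` or `g` constant `1` evaluates the marginal sums of the weights. -/
theorem trace_cfc_mul_cfc {A B : Matrix n n ℂ} (hA : A.IsHermitian) (hB : B.IsHermitian)
    (f g : ℝ → ℝ) :
    (cfc f A * cfc g B).trace =
      ((∑ i, ∑ j, f (hA.eigenvalues i) * g (hB.eigenvalues j) * overlap hA hB i j : ℝ) : ℂ) := by
  rw [cfc_eq_unitary_mul_diagonal_mul hA, cfc_eq_unitary_mul_diagonal_mul hB]
  set U := (hA.eigenvectorUnitary : Matrix n n ℂ)
  set W := (hB.eigenvectorUnitary : Matrix n n ℂ)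
  set D := diagonal (fun i => (f (hA.eigenvalues i) : ℂ))
  set D' := diagonal (fun i => (g (hB.eigenvalues i) : ℂ))
  have h1 : (U * D * Uᴴ * (W * D' * Wᴴ)).trace = (D * (Uᴴ * W) * D' * (Uᴴ * W)ᴴ).trace := by
    rw [conjTranspose_mul, conjTranspose_conjTranspose]
    simp only [Matrix.mul_assoc]
    rw [trace_mul_comm]
    simp only [Matrix.mul_assoc]
  rw [h1]
  simp only [trace, diag_apply, mul_apply (M := D * (Uᴴ * W) * D'), D, D', mul_diagonal,
    diagonal_mul, conjTranspose_apply]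
  push_cast
  refine Finset.sum_congr rfl fun i _ => Finset.sum_congr rfl fun j _ => ?_
  have h2 : (Uᴴ * W) i j * star ((Uᴴ * W) i j) = (overlap hA hB i j : ℂ) := by
    rw [overlap, Complex.star_def, Complex.mul_conj, Complex.normSq_eq_norm_sq]
  rw [← h2]
  ring

open scoped MatrixOrder Matrix.Norms.L2Operator in
theorem trace_mul_nonneg_of_posSemidef {A B : Matrix n n ℂ} (hA : A.PosSemidef)
    (hB : B.PosSemidef) : 0 ≤ (A * B).trace.re := by
  obtain ⟨C, rfl⟩ := CStarAlgebra.nonneg_iff_eq_star_mul_self.mp hA.nonneg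
  rw [star_eq_conjTranspose, Matrix.mul_assoc, trace_mul_comm]
  exact (Complex.le_def.mp (hB.mul_mul_conjTranspose_same C).trace_nonneg).1

end FunctionalCalculus

/-! ### Entropy inequalities -/

section Entropy

variable {n : Type*} [Fintype n] [DecidableEq n]

theorem log_two_mul_entropy (ρ : Matrix n n ℂ) :
    Real.log 2 * entropy ρ = (cfc Real.negMulLog ρ).trace.re := by
  have : Real.log 2 ≠ 0 := (Real.log_pos one_lt_two).ne'
  unfold entropy
  field_simp

/-- This is `log t ≤ t - 1` at `t = w / (c * r)`, multiplied by `r`. With `c = Tr ω`, the terms `w /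
c` and `r` each sum to `1` against the overlaps and cancel. -/
theorem mul_log_le {r w c : ℝ} (hr : 0 ≤ r) (hw : 0 < w) (hc : 0 < c) :
    r * Real.log w ≤ -Real.negMulLog r + r * Real.log c + w / c - r := by
  rcases hr.eq_or_lt with rfl | hr
  · simp; positivity
  · have h := Real.log_le_sub_one_of_pos (x := w / (c * r)) (by positivity)
    rw [Real.log_div hw.ne' (by positivity), Real.log_mul hc.ne' hr.ne'] at h
    have h2 := mul_le_mul_of_nonneg_left h hr.le
    have h3 : r * (w / (c * r) - 1) = w / c - r := by field_simp
    rw [h3] at h2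
    rw [Real.negMulLog]
    linarith

/-- **Gibbs' variational inequality**. -/
theorem trace_mul_log_le {ρ ω : Matrix n n ℂ} (hρ : ρ.PosSemidef) (hρ1 : ρ.trace = 1)
    (hω : ω.PosDef) :
    (ρ * cfc Real.log ω).trace.re ≤ -(cfc Real.negMulLog ρ).trace.re + Real.log ω.trace.re := by
  have hne : Nonempty n := by
    by_contra h
    rw [not_nonempty_iff] at h
    simp [trace] at hρ1
  set c := ω.trace.re with hcdef
  have hc : 0 < c := (Complex.lt_def.mp hω.trace_pos).1
  have hid : cfc (id : ℝ → ℝ) ρ = ρ := cfc_id ℝ ρ (ha := hρ.1)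
  have hid' : cfc (id : ℝ → ℝ) ω = ω := cfc_id ℝ ω (ha := hω.1)
  have hone : ∀ (A : Matrix n n ℂ), A.IsHermitian → cfc (fun _ : ℝ => (1 : ℝ)) A = 1 :=
    fun A hA => cfc_const_one ℝ A (ha := hA)
  have e1 := trace_cfc_mul_cfc hρ.1 hω.1 id Real.log
  have e2 := trace_cfc_mul_cfc hρ.1 hω.1 Real.negMulLog fun _ => 1
  have e3 := trace_cfc_mul_cfc hρ.1 hω.1 id fun _ => 1
  have e4 := trace_cfc_mul_cfc hρ.1 hω.1 (fun _ => 1) id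
  rw [hid] at e1 e3
  rw [hone _ hω.1, mul_one] at e2 e3
  rw [hone _ hρ.1, one_mul, hid'] at e4
  replace e4 : c = _ := congrArg Complex.re e4
  replace e3 := congrArg Complex.re e3
  rw [hρ1] at e3
  rw [e1, e2]
  simp only [Complex.ofReal_re, id, one_mul, mul_one, Complex.one_re] at e3 e4 ⊢
  have key : ∑ i, ∑ j, hρ.1.eigenvalues i * Real.log (hω.1.eigenvalues j) * overlap hρ.1 hω.1 i j
      ≤ ∑ i, ∑ j, (-Real.negMulLog (hρ.1.eigenvalues i) + hρ.1.eigenvalues i * Real.log c +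
        hω.1.eigenvalues j / c - hρ.1.eigenvalues i) * overlap hρ.1 hω.1 i j :=
    Finset.sum_le_sum fun i _ => Finset.sum_le_sum fun j _ => mul_le_mul_of_nonneg_right
      (mul_log_le (hρ.eigenvalues_nonneg i) (hω.eigenvalues_pos j) hc) (overlap_nonneg _ _ _ _)
  refine key.trans_eq ?_
  have h5 : ∑ i, ∑ j, (-Real.negMulLog (hρ.1.eigenvalues i) + hρ.1.eigenvalues i * Real.log c +
        hω.1.eigenvalues j / c - hρ.1.eigenvalues i) * overlap hρ.1 hω.1 i j =
      -(∑ i, ∑ j, Real.negMulLog (hρ.1.eigenvalues i) * overlap hρ.1 hω.1 i j) +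
        (∑ i, ∑ j, hρ.1.eigenvalues i * overlap hρ.1 hω.1 i j) * Real.log c +
        (∑ i, ∑ j, hω.1.eigenvalues j * overlap hρ.1 hω.1 i j) / c -
        ∑ i, ∑ j, hρ.1.eigenvalues i * overlap hρ.1 hω.1 i j := by
    simp only [Finset.sum_mul, Finset.sum_div, ← Finset.sum_neg_distrib, ← Finset.sum_add_distrib,
      ← Finset.sum_sub_distrib]
    refine Finset.sum_congr rfl fun i _ => Finset.sum_congr rfl fun j _ => ?_
    ring
  rw [h5, ← e3, ← e4, div_self hc.ne']
  ring

open scoped MatrixOrder Matrix.Norms.L2Operator in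
/-- The operator monotonicity of the logarithm bounds the entropy of `σ` from below when
`σ ≤ τ`. -/
theorem neg_trace_negMulLog_le {σ τ : Matrix n n ℂ} (hσ : σ.PosSemidef)
    (h : (τ - σ).PosSemidef) {δ : ℝ} (hδ : 0 < δ) :
    -(cfc Real.negMulLog σ).trace.re ≤ (σ * cfc Real.log (τ + (δ : ℂ) • 1)).trace.re := by
  have hδ1 : ((δ : ℂ) • (1 : Matrix n n ℂ)).PosDef := PosDef.one.smul (by simpa using hδ)
  have hpd : (σ + (δ : ℂ) • 1).PosDef := PosDef.posSemidef_add hσ hδ1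
  have hle : σ + (δ : ℂ) • 1 ≤ τ + (δ : ℂ) • 1 := by
    rw [Matrix.le_iff]
    simpa using h
  -- Operator monotonicity of the logarithm needs a strictly positive lower matrix, hence the shift
  -- of both sides by `δ`.
  have hlog := CFC.log_le_log hle (isStrictlyPositive_iff_posDef.mpr hpd)
  rw [CFC.log, CFC.log, Matrix.le_iff] at hlog
  have h1 := trace_mul_nonneg_of_posSemidef hσ hlog
  rw [mul_sub, trace_sub, Complex.sub_re, sub_nonneg] at h1
  refine le_trans ?_ h1
  have hsa : IsSelfAdjoint σ := hσ.1
  have h2 : cfc Real.log (σ + (δ : ℂ) • 1) = cfc (fun x => Real.log (x + δ)) σ := by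
    rw [cfc_comp' Real.log (fun x => x + δ) σ (continuousOn_image_spectrum _ _ _)
      (continuousOn_spectrum _ _), cfc_add_const δ (fun x => x) σ, cfc_id' ℝ σ,
      Algebra.algebraMap_eq_smul_one]
    rfl
  have h3 : σ * cfc Real.log (σ + (δ : ℂ) • 1) = cfc (fun x => x * Real.log (x + δ)) σ := by
    rw [h2, cfc_mul _ _ σ (continuousOn_spectrum _ _) (continuousOn_spectrum _ _), cfc_id' ℝ σ]
  rw [h3, trace_cfc hσ.1, trace_cfc hσ.1, Complex.re_sum, Complex.re_sum,
    ← Finset.sum_neg_distrib]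
  refine Finset.sum_le_sum fun i _ => ?_
  have hi := hσ.eigenvalues_nonneg i
  simp only [Complex.ofReal_re, Real.negMulLog, neg_mul, neg_neg]
  rcases hi.eq_or_lt with h0 | h0
  · simp [← h0]
  · exact mul_le_mul_of_nonneg_left (Real.log_le_log h0 (by linarith)) hi

end Entropy

end RSP

namespace RSP

open Matrix Polynomial

/-! ### Mutual information as a Holevo quantity -/

section MutualInformation

variable {X K : Type*} [Fintype X] [DecidableEq X] [Fintype K]

theorem isHermitian_smul_state (ρ : State K) (p : ℝ) : ((p : ℂ) • ρ.mat).IsHermitian := by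
  simp [IsHermitian, conjTranspose_smul, ρ.posSemidef.1.eq]

theorem cqState_apply (E : X → State K) (μ : X → ℝ) (x y : X) (k l : K) :
    cqState E μ (x, k) (y, l) = if x = y then (μ x : ℂ) * (E x).mat k l else 0 := by
  simp only [cqState, Matrix.sum_apply, Matrix.smul_apply, kroneckerMap_apply, single_apply,
    smul_eq_mul]
  rw [Finset.sum_eq_single x]
  · split_ifs <;> simp_all
  · intro z _ hz
    simp [hz]
  · simp

theorem cqState_eq_reindex (E : X → State K) (μ : X → ℝ) :
    cqState E μ = reindex (Equiv.prodComm K X) (Equiv.prodComm K X)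
      (blockDiagonal fun x => (μ x : ℂ) • (E x).mat) := by
  ext ⟨x, k⟩ ⟨y, l⟩
  simp [cqState_apply, blockDiagonal_apply]

theorem isHermitian_cqState (E : X → State K) (μ : X → ℝ) : (cqState E μ).IsHermitian := by
  ext ⟨x, k⟩ ⟨y, l⟩
  rw [conjTranspose_apply, cqState_apply, cqState_apply]
  by_cases h : x = y
  · subst h
    simp [← (E x).posSemidef.1.apply k l]
  · simp [h, Ne.symm h]

theorem traceSnd_cqState (E : X → State K) (μ : X → ℝ) :
    traceSnd (cqState E μ) = diagonal fun x => (μ x : ℂ) := by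
  ext x y
  simp only [traceSnd, of_apply, cqState_apply, diagonal_apply]
  split_ifs with h
  · rw [← Finset.mul_sum]
    have := (E x).trace_eq_one
    simp only [trace, diag_apply] at this
    rw [this, mul_one]
  · simp

theorem traceFst_cqState (E : X → State K) (μ : X → ℝ) :
    traceFst (cqState E μ) = ∑ x, (μ x : ℂ) • (E x).mat := by
  ext k l
  simp [traceFst, cqState_apply, Matrix.sum_apply]

variable [DecidableEq K]

theorem trace_negMulLog_smul {ρ : Matrix K K ℂ} (hρ : ρ.IsHermitian) (hρ1 : ρ.trace = 1) (p : ℝ) :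
    (cfc Real.negMulLog ((p : ℂ) • ρ)).trace.re =
      Real.negMulLog p + p * (cfc Real.negMulLog ρ).trace.re := by
  have hsa : IsSelfAdjoint ρ := hρ
  have h1 : cfc Real.negMulLog ((p : ℂ) • ρ) = cfc (fun x => Real.negMulLog (p * x)) ρ := by
    rw [cfc_comp_const_mul p Real.negMulLog ρ (continuousOn_image_spectrum _ _ _)]
    rfl
  have h2 : ∑ i, hρ.eigenvalues i = 1 := by
    have := congrArg Complex.re hρ.trace_eq_sum_eigenvalues
    rw [hρ1, Complex.re_sum] at this
    exact this.symm
  rw [h1, trace_cfc hρ, trace_cfc hρ]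
  simp only [Complex.re_sum, Complex.ofReal_re, Real.negMulLog_mul, Finset.sum_add_distrib,
    ← Finset.sum_mul, ← Finset.mul_sum, h2, one_mul]

theorem charpoly_blockDiagonal (M : X → Matrix K K ℂ) :
    (blockDiagonal M).charpoly = ∏ x, (M x).charpoly := by
  have h : charmatrix (blockDiagonal M) = blockDiagonal fun x => charmatrix (M x) := by
    ext ⟨k, x⟩ ⟨l, y⟩ : 2
    by_cases hxy : x = y
    · subst hxy
      simp [charmatrix_apply, blockDiagonal_apply, diagonal_apply]
    · simp [blockDiagonal_apply, hxy]
  rw [charpoly, h, det_blockDiagonal]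
  rfl

/-- The trace of `f` of a matrix depends only on its characteristic polynomial, which for a block
diagonal matrix is the product over the blocks; no eigenvectors of the large matrix are needed. -/
theorem trace_cfc_cqState (E : X → State K) (μ : X → ℝ) (f : ℝ → ℝ) :
    (cfc f (cqState E μ)).trace = ∑ x, (cfc f ((μ x : ℂ) • (E x).mat)).trace := by
  have hH := fun x => isHermitian_smul_state (E x) (μ x)
  rw [trace_cfc_of_charpoly_eq (isHermitian_cqState E μ) f
    (d := fun i : X × K => (hH i.1).eigenvalues i.2), Fintype.sum_prod_type]
  · exact Finset.sum_congr rfl fun x _ => (trace_cfc (hH x) f).symm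
  · rw [cqState_eq_reindex, charpoly_reindex, charpoly_blockDiagonal, Fintype.prod_prod_type]
    exact Finset.prod_congr rfl fun x _ => (hH x).charpoly_eq

/-- The mutual information of a classical-quantum state is its Holevo quantity. -/
theorem log_two_mul_info (E : X → State K) (μ : X → ℝ) :
    Real.log 2 * info E μ = (cfc Real.negMulLog (∑ x, (μ x : ℂ) • (E x).mat)).trace.re -
      ∑ x, μ x * (cfc Real.negMulLog (E x).mat).trace.re := by
  have hd : (diagonal fun x => (μ x : ℂ)).IsHermitian := by
    simp [IsHermitian, diagonal_conjTranspose, Pi.star_def]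
  rw [info, mutualInfo, mul_sub, mul_add, log_two_mul_entropy, log_two_mul_entropy,
    log_two_mul_entropy, traceSnd_cqState, traceFst_cqState, trace_cfc_cqState,
    trace_cfc_of_charpoly_eq hd _ (charpoly_diagonal _)]
  -- The block of `x` contributes `negMulLog (μ x)` besides its weighted entropy; these extra terms
  -- add up to the entropy of the classical marginal and cancel it.
  simp only [Complex.re_sum, Complex.ofReal_re,
    fun x => trace_negMulLog_smul (E x).posSemidef.1 (E x).trace_eq_one (μ x),
    Finset.sum_add_distrib]
  ring

/-- If all states of an encoding are dominated by one positive semidefinite matrix `τ`, then the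
information in the encoding is at most `log Tr τ`. -/
theorem log_two_mul_info_le (E : X → State K) {μ : X → ℝ} (hμ : μ ∈ stdSimplex ℝ X)
    {τ : Matrix K K ℂ} (hτ : τ.PosSemidef) (h : ∀ x, (τ - (E x).mat).PosSemidef)
    (hpos : 0 < τ.trace.re) : Real.log 2 * info E μ ≤ Real.log τ.trace.re := by
  set σ := ∑ x, (μ x : ℂ) • (E x).mat with hσdef
  have hσ : σ.PosSemidef := posSemidef_sum _ fun x _ =>
    (E x).posSemidef.smul (by simpa using hμ.1 x)
  have hσ1 : σ.trace = 1 := by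
    simp only [hσdef, trace_sum, trace_smul, (E _).trace_eq_one, smul_eq_mul, mul_one]
    exact_mod_cast hμ.2
  -- Since `τ` may be singular, the bound is proved for `τ + δ` and then `δ` tends to `0`.
  have key : ∀ δ : ℝ, 0 < δ →
      Real.log 2 * info E μ ≤ Real.log (τ.trace.re + δ * Fintype.card K) := by
    intro δ hδ
    set ω := τ + (δ : ℂ) • (1 : Matrix K K ℂ) with hωdef
    have hω : ω.PosDef := PosDef.posSemidef_add hτ (PosDef.one.smul (by simpa using hδ))
    have hωtr : ω.trace.re = τ.trace.re + δ * Fintype.card K := by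
      simp [hωdef, trace_add, trace_smul]
    have h1 := trace_mul_log_le hσ hσ1 hω
    have h2 : ∑ x, μ x * -(cfc Real.negMulLog (E x).mat).trace.re ≤
        (σ * cfc Real.log ω).trace.re := by
      rw [hσdef, Finset.sum_mul, trace_sum, Complex.re_sum]
      refine Finset.sum_le_sum fun x _ => ?_
      rw [smul_mul_assoc, trace_smul, smul_eq_mul, Complex.re_ofReal_mul]
      exact mul_le_mul_of_nonneg_left (neg_trace_negMulLog_le (E x).posSemidef (h x) hδ) (hμ.1 x)
    simp only [mul_neg, Finset.sum_neg_distrib] at h2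
    rw [log_two_mul_info, ← hωtr]
    linarith
  have hlim : Filter.Tendsto (fun δ : ℝ => Real.log (τ.trace.re + δ * Fintype.card K))
      (nhdsWithin 0 (Set.Ioi 0)) (nhds (Real.log τ.trace.re)) := by
    have : ContinuousAt (fun δ : ℝ => Real.log (τ.trace.re + δ * Fintype.card K)) 0 :=
      ContinuousAt.log (by fun_prop) (by simpa using hpos.ne')
    simpa using this.tendsto.mono_left nhdsWithin_le_nhds
  exact ge_of_tendsto hlim (Filter.eventually_of_mem self_mem_nhdsWithin key)

end MutualInformation

/-! ### States of fidelity one -/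

section Fidelity

variable {n : Type*} [Fintype n] [DecidableEq n]

theorem isHermitian_cfc (f : ℝ → ℝ) (A : Matrix n n ℂ) : (cfc f A).IsHermitian :=
  cfc_predicate f A

theorem cfc_sqrt_mul_self {A : Matrix n n ℂ} (hA : A.PosSemidef) :
    cfc Real.sqrt A * cfc Real.sqrt A = A := by
  have hsa : IsSelfAdjoint A := hA.1
  rw [← cfc_mul _ _ A (continuousOn_spectrum _ _) (continuousOn_spectrum _ _)]
  conv_rhs => rw [← cfc_id' ℝ A]
  refine cfc_congr fun x hx => ?_
  rw [hA.1.spectrum_real_eq_range_eigenvalues] at hx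
  obtain ⟨i, rfl⟩ := hx
  exact Real.mul_self_sqrt (hA.eigenvalues_nonneg i)

/-- States of fidelity one are equal. -/
theorem eq_of_one_le_fidelity {ρ σ : Matrix n n ℂ} (hσ : σ.PosSemidef) (hρ : ρ.PosSemidef)
    (hσ1 : σ.trace = 1) (hρ1 : ρ.trace = 1) (h : 1 ≤ fidelity σ ρ) : σ = ρ := by
  set P := cfc Real.sqrt σ with hP
  set R := cfc Real.sqrt ρ with hR
  have hPH : Pᴴ = P := isHermitian_cfc _ _
  have hRH : Rᴴ = R := isHermitian_cfc _ _
  have hPP : P * P = σ := cfc_sqrt_mul_self hσ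
  have hRR : R * R = ρ := cfc_sqrt_mul_self hρ
  set N := P * ρ * P with hN
  have hNpsd : N.PosSemidef := by
    have := hρ.mul_mul_conjTranspose_same P
    rwa [hPH] at this
  have hNsa : IsSelfAdjoint N := hNpsd.1
  have hspec : ∀ x ∈ spectrum ℝ N, 0 ≤ x := by
    intro x hx
    rw [hNpsd.1.spectrum_real_eq_range_eigenvalues] at hx
    obtain ⟨i, rfl⟩ := hx
    exact hNpsd.eigenvalues_nonneg i
  have hmul : ∀ f g : ℝ → ℝ, cfc f N * cfc g N = cfc (fun x => f x * g x) N := fun f g =>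
    (cfc_mul f g N (continuousOn_spectrum _ _) (continuousOn_spectrum _ _)).symm
  have hNid : N = cfc (fun x : ℝ => x) N := (cfc_id' ℝ N).symm
  set M := R * P with hM
  have hMM : Mᴴ * M = N := by
    rw [hM, conjTranspose_mul, hPH, hRH, hN, ← hRR]
    simp only [Matrix.mul_assoc]
  -- As `0⁻¹ = 0`, this is the pseudo-inverse of `√N`, so `N` need not be invertible.
  set G := cfc (fun x => (Real.sqrt x)⁻¹) N with hG
  have hGH : Gᴴ = G := isHermitian_cfc _ _
  -- `U` is the partial isometry of the polar decomposition of `M`.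
  set U := M * G with hU
  have hUM : Uᴴ * M = cfc Real.sqrt N := by
    rw [hU, conjTranspose_mul, hGH, Matrix.mul_assoc, hMM]
    conv_lhs => rw [hNid, hG, hmul]
    refine cfc_congr fun x hx => ?_
    have := Real.mul_self_sqrt (hspec x hx)
    by_cases h0 : Real.sqrt x = 0
    · simp [h0]
    · rw [inv_mul_eq_div, div_eq_iff h0, this]
  have hUUU : U * (Uᴴ * U) = U := by
    have h1 : Uᴴ * U = cfc Real.sqrt N * G := by
      conv_lhs => rw [hU, ← Matrix.mul_assoc, ← hU, hUM]
    rw [h1, hU, Matrix.mul_assoc]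
    congr 1
    rw [hG, hmul, hmul]
    refine cfc_congr fun x hx => ?_
    by_cases h0 : Real.sqrt x = 0
    · simp [h0]
    · field_simp
  have hproj : (1 - U * Uᴴ).PosSemidef := by
    have h1 : (1 - U * Uᴴ)ᴴ * (1 - U * Uᴴ) = 1 - U * Uᴴ := by
      have h2 : U * Uᴴ * (U * Uᴴ) = U * Uᴴ := by
        rw [Matrix.mul_assoc, ← Matrix.mul_assoc Uᴴ, ← Matrix.mul_assoc, hUUU]
      rw [conjTranspose_sub, conjTranspose_one, conjTranspose_mul, conjTranspose_conjTranspose,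
        mul_sub, mul_one, sub_mul, one_mul, h2, sub_self, sub_zero]
    rw [← h1]
    exact posSemidef_conjTranspose_mul_self _
  have hle : (ρ - R * (U * Uᴴ) * R).PosSemidef := by
    have := hproj.mul_mul_conjTranspose_same R
    rwa [hRH, mul_sub, sub_mul, mul_one, hRR] at this
  have htr1 : (R * (U * Uᴴ) * R).trace.re ≤ 1 := by
    have := (Complex.le_def.mp hle.trace_nonneg).1
    rw [trace_sub, hρ1] at this
    simpa using this
  have hF : 1 ≤ (Uᴴ * (R * P)).trace.re := by
    rw [← hM, hUM]
    exact h
  -- Equality case of Cauchy–Schwarz: the squared Hilbert–Schmidt norm of `P - R * U` is at most `1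
  -- - 2F + 1`, which is nonpositive when `F ≥ 1`.
  have hPRU : P = R * U := by
    have h1 : (P - R * U)ᴴ * (P - R * U) =
        P * P - P * (R * U) - (Uᴴ * (R * P)) + (R * U)ᴴ * (R * U) := by
      rw [conjTranspose_sub, conjTranspose_mul, hPH, hRH]
      simp only [mul_sub, sub_mul, Matrix.mul_assoc]
      abel
    have h2 : (P * (R * U)).trace.re = (Uᴴ * (R * P)).trace.re := by
      rw [← Complex.conj_re, ← Complex.star_def, ← trace_conjTranspose]
      simp only [conjTranspose_mul, hPH, hRH, Matrix.mul_assoc]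
    have h3 : ((R * U)ᴴ * (R * U)).trace = (R * (U * Uᴴ) * R).trace := by
      rw [trace_mul_comm, conjTranspose_mul, hRH]
      simp only [Matrix.mul_assoc]
    have hps := posSemidef_conjTranspose_mul_self (P - R * U)
    have h4 : ((P - R * U)ᴴ * (P - R * U)).trace.re ≤ 0 := by
      rw [h1, trace_add, trace_sub, trace_sub, h3, hPP, hσ1]
      simp only [Complex.add_re, Complex.sub_re, h2, Complex.one_re]
      linarith
    have h5 : ((P - R * U)ᴴ * (P - R * U)).trace = 0 := by
      obtain ⟨h6, h7⟩ := Complex.le_def.mp hps.trace_nonneg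
      exact Complex.ext (le_antisymm h4 h6) h7.symm
    exact sub_eq_zero.mp (trace_conjTranspose_mul_self_eq_zero_iff.mp h5)
  have hσR : R * (U * Uᴴ) * R = σ := by
    have : P * Pᴴ = σ := by rw [hPH, hPP]
    rw [hPRU, conjTranspose_mul, hRH] at this
    rw [← this]
    simp only [Matrix.mul_assoc]
  -- Now `ρ - σ` is positive semidefinite of trace zero, hence zero.
  rw [hσR] at hle
  have h0 := hle.trace_eq_zero_iff.mp (by rw [trace_sub, hσ1, hρ1, sub_self])
  exact (sub_eq_zero.mp h0).symm

end Fidelity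

end RSP

namespace RSP

open Matrix

/-! ### Partial traces and the dimension bound -/

section PartialTrace

variable {A B C : Type*}

theorem trace_traceFst [Fintype A] [Fintype B] (ρ : Matrix (A × B) (A × B) ℂ) :
    (traceFst ρ).trace = ρ.trace := by
  simp only [trace, diag_apply, traceFst, of_apply, Fintype.sum_prod_type]
  exact Finset.sum_comm

theorem traceFst_sub [Fintype A] (ρ σ : Matrix (A × B) (A × B) ℂ) :
    traceFst (ρ - σ) = traceFst ρ - traceFst σ := by
  ext b b'
  simp [traceFst]

theorem traceFst_eq_sum_submatrix [Fintype A] (ρ : Matrix (A × B) (A × B) ℂ) :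
    traceFst ρ = ∑ a, ρ.submatrix (fun b => (a, b)) (fun b => (a, b)) := by
  ext b b'
  simp [traceFst, Matrix.sum_apply]

theorem posSemidef_traceFst [Fintype A] [Fintype B] {ρ : Matrix (A × B) (A × B) ℂ}
    (hρ : ρ.PosSemidef) : (traceFst ρ).PosSemidef := by
  rw [traceFst_eq_sum_submatrix]
  exact posSemidef_sum _ fun a _ => hρ.submatrix _

theorem traceFst_reindex_prodAssoc [Fintype A] [Fintype B]
    (ρ : Matrix ((A × B) × C) ((A × B) × C) ℂ) :
    traceFst (traceFst (reindex (Equiv.prodAssoc A B C) (Equiv.prodAssoc A B C) ρ)) =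
      traceFst ρ := by
  ext c c'
  simp only [traceFst, of_apply, reindex_apply, submatrix_apply, Equiv.prodAssoc_symm_apply,
    Fintype.sum_prod_type]
  exact Finset.sum_comm

theorem traceFst_reindex_prodAssoc_symm [Fintype A] [Fintype B]
    (ρ : Matrix (A × B × C) (A × B × C) ℂ) :
    traceFst (reindex (Equiv.prodAssoc A B C).symm (Equiv.prodAssoc A B C).symm ρ) =
      traceFst (traceFst ρ) := by
  ext c c'
  simp only [traceFst, of_apply, reindex_apply, submatrix_apply, Equiv.symm_symm,
    Equiv.prodAssoc_apply, Fintype.sum_prod_type]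
  exact Finset.sum_comm

theorem trace_reindex [Fintype A] [Fintype B] (e : A ≃ B) (ρ : Matrix A A ℂ) :
    (reindex e e ρ).trace = ρ.trace := by
  simp only [trace, diag_apply, reindex_apply, submatrix_apply]
  exact Equiv.sum_comp e.symm fun a => ρ a a

theorem one_kronecker_sub [DecidableEq A] (M N : Matrix B B ℂ) :
    (1 : Matrix A A ℂ) ⊗ₖ (M - N) = 1 ⊗ₖ M - 1 ⊗ₖ N := by
  ext i j
  simp [mul_sub]

/-- A bipartite positive matrix is at most `dim A` times `1 ⊗ Tr_A ρ`. -/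
theorem posSemidef_card_smul_one_kronecker_traceFst_sub [Fintype A] [DecidableEq A]
    [Fintype B] [DecidableEq B] {ρ : Matrix (A × B) (A × B) ℂ} (hρ : ρ.PosSemidef) :
    ((Fintype.card A : ℂ) • ((1 : Matrix A A ℂ) ⊗ₖ traceFst ρ) - ρ).PosSemidef := by
  -- `T a a'` moves the block `a'` to the block `a`.
  set T : A → A → Matrix (A × B) (A × B) ℂ := fun a a' => single a a' 1 ⊗ₖ 1 with hT
  have hTapply : ∀ a a' c c' (i j : A × B), (T a a' * ρ * (T c c')ᴴ) i j =
      if a = i.1 ∧ c = j.1 then ρ (a', i.2) (c', j.2) else 0 := by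
    intro a a' c c' i j
    simp only [hT, mul_apply, Fintype.sum_prod_type, conjTranspose_kronecker, conjTranspose_one,
      conjTranspose_single, star_one, kroneckerMap_apply, one_apply, single_apply]
    by_cases h1 : a = i.1 <;> by_cases h2 : c = j.1 <;> simp [h1, h2]
  have hone : ∑ a, T a a = 1 := by
    ext ⟨a, b⟩ ⟨c, d⟩
    by_cases h : a = c
    · subst h
      simp [hT, Matrix.sum_apply, single_apply, one_apply]
    · simp only [hT, Matrix.sum_apply, kroneckerMap_apply, single_apply, one_apply, Prod.mk.injEq,
        h, false_and, if_false]
      refine Finset.sum_eq_zero fun x _ => ?_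
      rw [if_neg, zero_mul]
      rintro ⟨rfl, rfl⟩
      exact h rfl
  have h1 : (1 : Matrix A A ℂ) ⊗ₖ traceFst ρ =
      ∑ a, ∑ a', T a a' * ρ * (T a a')ᴴ := by
    ext ⟨a, b⟩ ⟨c, d⟩
    simp only [Matrix.sum_apply, hTapply, kroneckerMap_apply, traceFst, of_apply, one_apply]
    by_cases h : a = c
    · subst h
      simp
    · simp only [h, if_false, zero_mul]
      symm
      refine Finset.sum_eq_zero fun x _ => Finset.sum_eq_zero fun y _ => if_neg ?_
      rintro ⟨rfl, rfl⟩
      exact h rfl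
  -- The pinching inequality as a sum of squares: since `∑ a, T a a = 1`, expanding the right side
  -- gives `card A` times the pinched matrix minus `ρ`.
  have h2 : (Fintype.card A : ℂ) • ∑ a, T a a * ρ * (T a a)ᴴ - ρ =
      (1 / 2 : ℂ) • ∑ a, ∑ c, (T a a - T c c) * ρ * (T a a - T c c)ᴴ := by
    have h3 : ∑ a, ∑ c, T a a * ρ * (T c c)ᴴ = ρ := by
      simp only [← Finset.mul_sum, ← Finset.sum_mul, ← conjTranspose_sum, hone]
      simp
    have h4 : ∑ a, ∑ c, T c c * ρ * (T a a)ᴴ = ρ := by rw [Finset.sum_comm, h3]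
    simp only [conjTranspose_sub, mul_sub, sub_mul, Finset.sum_sub_distrib, h3, h4,
      Finset.sum_const, Finset.card_univ, ← Nat.cast_smul_eq_nsmul ℂ, ← Finset.smul_sum]
    module
  -- The summands with `a = a'` form the pinching just treated; the others are positive
  -- semidefinite.
  have h5 : (Fintype.card A : ℂ) • ((1 : Matrix A A ℂ) ⊗ₖ traceFst ρ) - ρ =
      (Fintype.card A : ℂ) • ∑ a, ∑ a' ∈ Finset.univ.erase a, T a a' * ρ * (T a a')ᴴ +
        (1 / 2 : ℂ) • ∑ a, ∑ c, (T a a - T c c) * ρ * (T a a - T c c)ᴴ := by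
    have h6 : ∀ a, ∑ a', T a a' * ρ * (T a a')ᴴ =
        ∑ a' ∈ Finset.univ.erase a, T a a' * ρ * (T a a')ᴴ + T a a * ρ * (T a a)ᴴ :=
      fun a => (Finset.sum_erase_add _ _ (Finset.mem_univ a)).symm
    rw [← h2, h1, Finset.sum_congr rfl fun a _ => h6 a, Finset.sum_add_distrib, smul_add]
    abel
  rw [h5]
  refine PosSemidef.add (PosSemidef.smul ?_ (Nat.cast_nonneg _)) (PosSemidef.smul ?_ ?_)
  · exact posSemidef_sum _ fun a _ => posSemidef_sum _ fun a' _ =>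
      hρ.mul_mul_conjTranspose_same _
  · exact posSemidef_sum _ fun a _ => posSemidef_sum _ fun a' _ =>
      hρ.mul_mul_conjTranspose_same _
  · rw [Complex.le_def]
    norm_num

end PartialTrace

/-! ### Channels acting on one factor -/

namespace Channel

variable {m n A B : Type*} [Fintype m] [DecidableEq m] [Fintype n]

theorem posSemidef_apply (Φ : Channel m n) {ρ : Matrix m m ℂ} (hρ : ρ.PosSemidef) :
    (Φ.apply ρ).PosSemidef :=
  posSemidef_sum _ fun i _ => hρ.mul_mul_conjTranspose_same (Φ.kraus i)

theorem apply_sub (Φ : Channel m n) (ρ σ : Matrix m m ℂ) :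
    Φ.apply (ρ - σ) = Φ.apply ρ - Φ.apply σ := by
  simp only [apply, Matrix.mul_sub, Matrix.sub_mul, Finset.sum_sub_distrib]

theorem trace_apply (Φ : Channel m n) (ρ : Matrix m m ℂ) : (Φ.apply ρ).trace = ρ.trace := by
  have h : ∀ i, (Φ.kraus i * ρ * (Φ.kraus i)ᴴ).trace = ((Φ.kraus i)ᴴ * Φ.kraus i * ρ).trace :=
    fun i => by rw [trace_mul_comm, Matrix.mul_assoc]
  rw [apply, trace_sum, Finset.sum_congr rfl fun i _ => h i, ← trace_sum, ← Finset.sum_mul,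
    Φ.sum_eq_one, one_mul]

theorem posSemidef_applyFst [Fintype B] [DecidableEq B] (Φ : Channel m n)
    {ρ : Matrix (m × B) (m × B) ℂ} (hρ : ρ.PosSemidef) : (Φ.applyFst ρ).PosSemidef :=
  posSemidef_sum _ fun _ _ => hρ.mul_mul_conjTranspose_same _

theorem posSemidef_applySnd [Fintype A] [DecidableEq A] (Φ : Channel m n)
    {ρ : Matrix (A × m) (A × m) ℂ} (hρ : ρ.PosSemidef) : (Φ.applySnd ρ).PosSemidef :=
  posSemidef_sum _ fun _ _ => hρ.mul_mul_conjTranspose_same _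

/-- A local operation of one party does not change the reduced state of the other party. -/
theorem traceFst_applyFst [Fintype B] [DecidableEq B] (Φ : Channel m n)
    (ρ : Matrix (m × B) (m × B) ℂ) : traceFst (Φ.applyFst ρ) = traceFst ρ := by
  -- For fixed `b`, `b'` the channel acts on one block of `ρ`, and the entry is the trace of the
  -- image of that block.
  have key : ∀ b b', traceFst (Φ.applyFst ρ) b b' =
      (Φ.apply (ρ.submatrix (fun a => (a, b)) (fun a => (a, b')))).trace := by
    intro b b'
    simp only [traceFst, of_apply, applyFst, apply, trace, diag_apply, Matrix.sum_apply]
    refine Finset.sum_congr rfl fun c _ => Finset.sum_congr rfl fun i _ => ?_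
    simp only [mul_apply, Fintype.sum_prod_type, conjTranspose_kronecker, conjTranspose_one,
      kroneckerMap_apply, conjTranspose_apply, one_apply, submatrix_apply]
    simp
  ext b b'
  rw [key, trace_apply]
  rfl

theorem traceFst_applySnd [Fintype A] [DecidableEq A] (Φ : Channel m n)
    (ρ : Matrix (A × m) (A × m) ℂ) : traceFst (Φ.applySnd ρ) = Φ.apply (traceFst ρ) := by
  have key : ∀ i, ∀ a b b', (((1 : Matrix A A ℂ) ⊗ₖ Φ.kraus i) * ρ *
      ((1 : Matrix A A ℂ) ⊗ₖ Φ.kraus i)ᴴ) (a, b) (a, b') =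
      (Φ.kraus i * ρ.submatrix (fun b => (a, b)) (fun b => (a, b)) * (Φ.kraus i)ᴴ) b b' := by
    intro i a b b'
    simp only [mul_apply, Fintype.sum_prod_type, conjTranspose_kronecker, conjTranspose_one,
      kroneckerMap_apply, conjTranspose_apply, one_apply, submatrix_apply]
    simp
  rw [traceFst_eq_sum_submatrix ρ, apply]
  ext b b'
  simp only [traceFst, of_apply, applySnd, Matrix.sum_apply, key, Matrix.mul_sum, Matrix.sum_mul]
  exact Finset.sum_comm

end Channel

/-! ### Propagating the uniform bound through the rounds -/

namespace Rounds

universe u v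

variable {X : Type u} {K : Type v} [Fintype K]

theorem posSemidef_run (x : X) {A B : Type} [Fintype A] [DecidableEq A] [Fintype B]
    [DecidableEq B] (P : Rounds X K A B) :
    ∀ ρ : Matrix (A × B) (A × B) ℂ, ρ.PosSemidef → (P.run x ρ).PosSemidef := by
  induction P with
  | output Φ => exact fun ρ hρ => Φ.posSemidef_apply (posSemidef_traceFst hρ)
  | aliceSends q Φ P ih =>
    exact fun ρ hρ => ih _ (((Φ x).posSemidef_applyFst hρ).submatrix _)
  | bobSends q Φ P ih =>
    exact fun ρ hρ => ih _ ((Φ.posSemidef_applySnd hρ).submatrix _)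

theorem trace_run (x : X) {A B : Type} [Fintype A] [DecidableEq A] [Fintype B]
    [DecidableEq B] (P : Rounds X K A B) :
    ∀ ρ : Matrix (A × B) (A × B) ℂ, (P.run x ρ).trace = ρ.trace := by
  induction P with
  | output Φ =>
    intro ρ
    rw [run, Φ.trace_apply, trace_traceFst]
  | aliceSends q Φ P ih =>
    intro ρ
    rw [run, ih, trace_reindex, ← trace_traceFst, Channel.traceFst_applyFst, trace_traceFst]
  | bobSends q Φ P ih =>
    intro ρ
    rw [run, ih, trace_reindex, ← trace_traceFst, Channel.traceFst_applySnd, Channel.trace_apply,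
      trace_traceFst]

/-- A bound `τ` on Bob's reduced state, uniform in Alice's input, is turned by a protocol of cost
`q` into a uniform bound on Bob's output whose trace is larger by the factor `4 ^ q`. -/
theorem exists_uniform_bound {A B : Type} [Fintype A] [DecidableEq A] [Fintype B]
    [DecidableEq B] (P : Rounds X K A B) :
    ∀ τ : Matrix B B ℂ, τ.PosSemidef → ∃ τ' : Matrix K K ℂ, τ'.PosSemidef ∧
      τ'.trace.re ≤ 4 ^ P.cost * τ.trace.re ∧
      ∀ (x : X) (ρ : Matrix (A × B) (A × B) ℂ), ρ.PosSemidef → (τ - traceFst ρ).PosSemidef →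
        (τ' - P.run x ρ).PosSemidef := by
  induction P with
  | output Φ =>
    intro τ hτ
    refine ⟨Φ.apply τ, Φ.posSemidef_apply hτ, by simp [cost, Φ.trace_apply], fun x ρ _ h => ?_⟩
    rw [run, ← Channel.apply_sub]
    exact Φ.posSemidef_apply h
  | aliceSends q Φ P ih =>
    intro τ hτ
    have hcard : (0 : ℂ) ≤ (Fintype.card (Qubits q) : ℂ) := Nat.cast_nonneg _
    -- One factor `2^q` of the trace comes from the scalar and one from `Tr 1`, whence `4^q`.
    obtain ⟨τ', hτ', htr, hb⟩ := ih ((Fintype.card (Qubits q) : ℂ) • (1 ⊗ₖ τ))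
      ((PosSemidef.one.kronecker hτ).smul hcard)
    refine ⟨τ', hτ', ?_, fun x ρ hρ h => ?_⟩
    · refine htr.trans_eq ?_
      have h1 : ((Fintype.card (Qubits q) : ℂ) •
          ((1 : Matrix (Qubits q) (Qubits q) ℂ) ⊗ₖ τ)).trace = ((4 ^ q : ℝ) : ℂ) * τ.trace := by
        rw [trace_smul, trace_kronecker, trace_one]
        simp only [Fintype.card_fun, Fintype.card_fin, Nat.cast_pow, Nat.cast_ofNat, smul_eq_mul]
        rw [show (4 : ℝ) = 2 * 2 by norm_num]
        push_cast
        rw [mul_pow]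
        ring
      rw [h1, Complex.re_ofReal_mul, cost, pow_add]
      ring
    · have hω := ((Φ x).posSemidef_applyFst hρ).submatrix (Equiv.prodAssoc _ _ _).symm
      refine hb x _ hω ?_
      -- With `ω'` the state of the message and Bob's register, `ω' ≤ 2^q • (1 ⊗ traceFst ρ) ≤ 2^q •
      -- (1 ⊗ τ)`: `h1` is the first inequality, `h2` the second.
      have hω' := posSemidef_traceFst hω
      have h1 := posSemidef_card_smul_one_kronecker_traceFst_sub hω'
      have h2 := ((PosSemidef.one (n := Qubits q) (R := ℂ)).kronecker h).smul hcard
      have h3 : traceFst (traceFst (((Φ x).applyFst ρ).submatrix (Equiv.prodAssoc _ _ _).symm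
          (Equiv.prodAssoc _ _ _).symm)) = traceFst ρ :=
        (traceFst_reindex_prodAssoc _).trans ((Φ x).traceFst_applyFst ρ)
      rw [h3] at h1
      rw [one_kronecker_sub, smul_sub] at h2
      have h4 := h2.add h1
      rwa [sub_add_sub_cancel] at h4
  | bobSends q Φ P ih =>
    intro τ hτ
    obtain ⟨τ', hτ', htr, hb⟩ := ih (traceFst (Φ.apply τ))
      (posSemidef_traceFst (Φ.posSemidef_apply hτ))
    refine ⟨τ', hτ', ?_, fun x ρ hρ h => ?_⟩
    · rw [trace_traceFst, Φ.trace_apply] at htr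
      have h0 : 0 ≤ τ.trace.re := (Complex.le_def.mp hτ.trace_nonneg).1
      -- Qubits sent by Bob do not enlarge the bound, so the factor `4^q` is pure slack here.
      refine htr.trans (mul_le_mul_of_nonneg_right ?_ h0)
      rw [cost]
      exact pow_le_pow_right₀ (by norm_num) (Nat.le_add_left _ _)
    · refine hb x _ ((Φ.posSemidef_applySnd hρ).submatrix _) ?_
      rw [traceFst_reindex_prodAssoc_symm, Φ.traceFst_applySnd, ← traceFst_sub,
        ← Channel.apply_sub]
      exact posSemidef_traceFst (Φ.posSemidef_apply h)

end Rounds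

end RSP

namespace RSP

open Matrix

universe u v

/-! ### The lower bound on communication -/

section LowerBound

variable {X : Type u} {K : Type v} [Fintype X] [DecidableEq X] [Fintype K] [DecidableEq K]

/-- A protocol that prepares the states exactly exchanges at least half as many qubits as there
is information in the encoding. -/
theorem Protocol.info_le_two_mul_cost {E : X → State K} {P : Protocol X K} (hP : P.Solves E 0)
    {μ : X → ℝ} (hμ : μ ∈ stdSimplex ℝ X) : info E μ ≤ 2 * P.cost := by
  obtain ⟨A, B, ρ, R⟩ := P
  have hR : ∀ x, R.run x ρ.mat = (E x).mat := by
    intro x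
    refine eq_of_one_le_fidelity (R.posSemidef_run x _ ρ.posSemidef) (E x).posSemidef
      ((R.trace_run x _).trans ρ.trace_eq_one) (E x).trace_eq_one ?_
    have := hP x
    rwa [sub_zero] at this
  -- The initial bound is Bob's share of the prior entanglement itself, of trace one and the same
  -- for all inputs.
  obtain ⟨τ, hτ, htr, hb⟩ := R.exists_uniform_bound _ (posSemidef_traceFst ρ.posSemidef)
  have hE : ∀ x, (τ - (E x).mat).PosSemidef := fun x => by
    have := hb x ρ.mat ρ.posSemidef (by rw [sub_self]; exact PosSemidef.zero)
    rwa [hR] at this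
  rw [trace_traceFst, ρ.trace_eq_one, Complex.one_re, mul_one] at htr
  have hX : Nonempty X := by
    by_contra h
    rw [not_nonempty_iff] at h
    simpa using hμ.2
  obtain ⟨x⟩ := hX
  have hpos : 0 < τ.trace.re := by
    have := (Complex.le_def.mp (hE x).trace_nonneg).1
    rw [trace_sub, (E x).trace_eq_one, Complex.sub_re, Complex.zero_re, Complex.one_re] at this
    linarith
  have h1 := (log_two_mul_info_le E hμ hτ hE hpos).trans (Real.log_le_log hpos htr)
  rw [Real.log_pow, show (4 : ℝ) = 2 ^ 2 by norm_num, Real.log_pow] at h1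
  have h2 : Real.log 2 * info E μ ≤ Real.log 2 * (2 * R.cost) := by
    refine h1.trans_eq ?_
    push_cast
    ring
  exact le_of_mul_le_mul_left h2 (Real.log_pos one_lt_two)

theorem Protocol.maxInfo_le_two_mul_cost {E : X → State K} {P : Protocol X K}
    (hP : P.Solves E 0) : maxInfo E ≤ 2 * P.cost := by
  -- The supremum of the empty set is `0`, so nonnegativity of the bound also covers an empty `X`.
  refine Real.sSup_le ?_ (by positivity)
  rintro _ ⟨μ, hμ, rfl⟩
  exact P.info_le_two_mul_cost hP hμ

end LowerBound

end RSP

theorem mainTheorem2 {X K : Type*} [Fintype X] [DecidableEq X] [Fintype K] [DecidableEq K]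
    (E : X → RSP.State K) :
    ((RSP.maxInfo E / 2 : ℝ) : EReal) ≤ ((RSP.Qpub E 0 : ℝ≥0∞) : EReal) := by
  -- Costs are natural numbers, so the bound may be rounded up; this allows the infimum to be
  -- compared inside `ℕ∞`, including the value `⊤`.
  have h : (⌈RSP.maxInfo E / 2⌉₊ : ℕ∞) ≤ RSP.Qpub E 0 := by
    refine le_iInf₂ fun P hP => ?_
    have := P.maxInfo_le_two_mul_cost hP
    exact_mod_cast Nat.ceil_le.mpr (by linarith)
  have h2 : ((⌈RSP.maxInfo E / 2⌉₊ : ℝ≥0∞) : EReal) ≤ ((RSP.Qpub E 0 : ℝ≥0∞) : EReal) := by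
    rw [EReal.coe_ennreal_le_coe_ennreal_iff]
    exact_mod_cast h
  refine le_trans ?_ h2
  have h3 : ((⌈RSP.maxInfo E / 2⌉₊ : ℝ≥0∞) : EReal) = ((⌈RSP.maxInfo E / 2⌉₊ : ℝ) : EReal) := by
    norm_cast
  rw [h3, EReal.coe_le_coe_iff]
  exact Nat.le_ceil _
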